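/- Let $G$ be a finite group, let $p$ be a prime, let $P$ be a Sylow $p$-subgroup of $G$, and assume that $|N_G(P)|$ is odd. Let $\chi$ be an irreducible complex character of $G$ whose degree $\chi(1)$ is not divisible by $p$. If $\chi$ is real-valued, then every solvable normal subgroup $N$ of $G$ is contained in $\ker\chi=\{g\in G : \chi(g)=\chi(1)\}$. -/

import Mathlib

/-- `χ` is an irreducible complex character of `G`: the trace function of an irreducible
representation of `G` on some `ℂⁿ`. (An irreducible representation is nonzero, so `n ≥ 1`.) -/
def IsIrreducibleCharacter {G : Type*} [Group G] (χ : G → ℂ) : Prop :=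
  ∃ (n : ℕ) (ρ : Representation ℂ G (Fin n → ℂ)), ρ.IsIrreducible ∧ χ = ρ.character

/-- The set of irreducible complex characters of `G` whose degree `χ 1` is a natural number
not divisible by `p`. -/
def irrPrimeDegree (p : ℕ) (G : Type*) [Group G] : Set (G → ℂ) :=
  {χ | IsIrreducibleCharacter χ ∧ ∃ d : ℕ, χ 1 = (d : ℂ) ∧ ¬ p ∣ d}

/-- A complex-valued function is real-valued. -/
def IsRealValued {G : Type*} (χ : G → ℂ) : Prop :=
  ∀ g : G, ∃ r : ℝ, χ g = (r : ℂ)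

/-- The kernel of a character `χ`, the set of all `g` with `χ g = χ 1`. -/
def characterKernel {G : Type*} [Group G] (χ : G → ℂ) : Set G :=
  {g | χ g = χ 1}

/-! Descending the derived series of `N` reduces to the case where `ρ` is abelian on `N`. Then `V`
is the sum of weight spaces of `N`, which `G` permutes transitively. Their number divides the
degree, hence is prime to `p`, and `P` fixes a weight `μ`. Burnside's fusion argument (the lemma
below: `P`-fixed points in one `G`-orbit are `N_G(P)`-conjugate) is used twice. Applied to `μ` and
its conjugate, which is a weight because the character is real, it makes `μ` real, as an element of
odd order cannot swap two points. Applied to cosets of `P ⊔ ker ρ`, it shows that elements of `N`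
centralized by `P` modulo `ker ρ` act with odd order, so the real `μ` is 1 on them. A norm over `P`
then gives `μ = 1` everywhere, and irreducibility spreads this to all of `V`. -/

theorem Sylow.exists_mem_normalizer_smul_eq {G : Type*} [Group G] [Finite G] {p : ℕ}
    [Fact p.Prime] (P : Sylow p G) {X : Type*} [MulAction G X] {a : X} {g : G}
    (ha : ∀ x ∈ P, x • a = a) (hga : ∀ x ∈ P, x • g • a = g • a) :
    ∃ n ∈ Subgroup.normalizer (P : Set G), n • a = g • a := by
  have h1 : (P : Subgroup G) ≤ MulAction.stabilizer G (g • a) := fun x hx => hga x hx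
  have h2 : ((g • P : Sylow p G) : Subgroup G) ≤ MulAction.stabilizer G (g • a) := by
    intro x hx
    rw [Sylow.coe_subgroup_smul, Subgroup.mem_pointwise_smul_iff_inv_smul_mem] at hx
    have h := ha _ hx
    rw [MulAction.mem_stabilizer_iff]
    have h' := congrArg (g • ·) h
    simpa [MulAut.smul_def, ← mul_smul, mul_assoc] using h'
  -- `P` and its conjugate by `g` are both Sylow in the stabilizer of `g • a`, hence conjugate
  -- there.
  obtain ⟨t, ht⟩ := MulAction.exists_smul_eq (MulAction.stabilizer G (g • a))
    ((g • P).subtype h2) (P.subtype h1)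
  rw [Sylow.smul_subtype] at ht
  have ht' := Sylow.subtype_injective ht
  refine ⟨t * g, ?_, ?_⟩
  · rw [← Sylow.smul_eq_iff_mem_normalizer, mul_smul]
    exact ht'
  · rw [mul_smul]
    exact t.2

/-! ### Weights of a subgroup acting by commuting operators -/

namespace Representation

variable {G V : Type*} [Group G] [AddCommGroup V] [Module ℂ V] (ρ : Representation ℂ G V)

theorem IsIrreducible.eq_top_of_invariant {ρ : Representation ℂ G V} (hρ : ρ.IsIrreducible)
    (S : Submodule ℂ V) (hS : ∀ g, ∀ v ∈ S, ρ g v ∈ S) (hne : S ≠ ⊥) : S = ⊤ := by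
  let T : Subrepresentation ρ := ⟨S, fun g v hv => hS g v hv⟩
  rcases eq_bot_or_eq_top T with h | h
  · exact absurd (congrArg Subrepresentation.toSubmodule h) hne
  · exact congrArg Subrepresentation.toSubmodule h

/-- The simultaneous eigenspace of the elements of `N` with eigenvalues `μ`. -/
def weightSpace (N : Subgroup G) (μ : N → ℂ) : Submodule ℂ V :=
  ⨅ m : N, Module.End.eigenspace (ρ m) (μ m)

variable {N : Subgroup G}

theorem mem_weightSpace {μ : N → ℂ} {v : V} :
    v ∈ ρ.weightSpace N μ ↔ ∀ m : N, ρ m v = μ m • v := by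
  simp [weightSpace, Submodule.mem_iInf]

theorem isSemisimple_apply [Finite G] (g : G) : Module.End.IsSemisimple (ρ g) := by
  have ho : 0 < orderOf g := orderOf_pos g
  refine Module.End.isSemisimple_of_squarefree_aeval_eq_zero
    (p := Polynomial.X ^ orderOf g - 1) ?_ ?_
  · exact (Polynomial.separable_X_pow_sub_C (1 : ℂ)
      (by exact_mod_cast ho.ne') one_ne_zero).squarefree
  · rw [map_sub, map_pow, Polynomial.aeval_X, ← map_pow, pow_orderOf_eq_one]
    simp

theorem weightSpace_eq [Finite G] (μ : N → ℂ) :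
    ρ.weightSpace N μ = ⨅ m : N, Module.End.maxGenEigenspace (ρ m) (μ m) := by
  simp only [weightSpace,
    (ρ.isSemisimple_apply _).isFinitelySemisimple.maxGenEigenspace_eq_eigenspace]

section Commuting

variable (hc : ∀ a ∈ N, ∀ b ∈ N, Commute (ρ a) (ρ b))
include hc

theorem iSupIndep_weightSpace [Finite G] : iSupIndep (ρ.weightSpace N) := by
  rw [funext (ρ.weightSpace_eq (N := N))]
  exact Module.End.independent_iInf_maxGenEigenspace_of_forall_mapsTo (fun m : N => ρ m)
    fun i j φ => Module.End.mapsTo_maxGenEigenspace_of_comm (hc _ j.2 _ i.2) φ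

theorem iSup_weightSpace [Finite G] [FiniteDimensional ℂ V] :
    ⨆ μ, ρ.weightSpace N μ = ⊤ := by
  rw [funext (ρ.weightSpace_eq (N := N))]
  exact Module.End.iSup_iInf_maxGenEigenspace_eq_top_of_iSup_maxGenEigenspace_eq_top_of_commute
    (fun m : N => ρ m) (fun i j _ => hc _ i.2 _ j.2)
    fun i => Module.End.iSup_maxGenEigenspace_eq_top _

end Commuting

variable (N) in
/-- The weights of `N` in `ρ`. -/
def Weight : Type _ := {μ : N → ℂ // ρ.weightSpace N μ ≠ ⊥}

variable {ρ}

theorem apply_mem_weightSpace [N.Normal] {μ : N → ℂ} {v : V} (hv : v ∈ ρ.weightSpace N μ) (g : G) :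
    ρ g v ∈ ρ.weightSpace N (fun m => μ (MulAut.conjNormal g⁻¹ m)) := by
  rw [mem_weightSpace] at hv ⊢
  intro m
  rw [← map_smul, ← hv, ← Module.End.mul_apply, ← Module.End.mul_apply, ← map_mul, ← map_mul]
  simp [mul_assoc]

instance [N.Normal] : MulAction G (ρ.Weight N) where
  smul g μ := ⟨fun m => μ.1 (MulAut.conjNormal g⁻¹ m), by
    obtain ⟨v, hv, hv0⟩ := Submodule.exists_mem_ne_zero_of_ne_bot μ.2
    refine Submodule.ne_bot_iff _ |>.2 ⟨ρ g v, apply_mem_weightSpace hv g, fun h => hv0 ?_⟩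
    simpa [← Module.End.mul_apply, ← map_mul] using congrArg (ρ g⁻¹) h⟩
  one_smul μ := Subtype.ext <| funext fun m => by
    change μ.1 _ = _
    simp
  mul_smul g h μ := Subtype.ext <| funext fun m => by
    change μ.1 _ = μ.1 _
    simp

theorem Weight.smul_val [N.Normal] (g : G) (μ : ρ.Weight N) (m : N) :
    (g • μ).1 m = μ.1 (MulAut.conjNormal g⁻¹ m) := rfl

theorem Weight.apply_mem [N.Normal] (μ : ρ.Weight N) (g : G) {v : V}
    (hv : v ∈ ρ.weightSpace N μ.1) : ρ g v ∈ ρ.weightSpace N (g • μ).1 :=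
  apply_mem_weightSpace hv g

theorem Weight.finrank_le_smul [N.Normal] [FiniteDimensional ℂ V] (μ : ρ.Weight N) (g : G) :
    Module.finrank ℂ (ρ.weightSpace N μ.1) ≤ Module.finrank ℂ (ρ.weightSpace N (g • μ).1) := by
  refine LinearMap.finrank_le_finrank_of_injective
    (f := (ρ g).restrict (p := ρ.weightSpace N μ.1) fun v hv => μ.apply_mem g hv) ?_
  intro a b h
  have h' := congrArg (fun w => ρ g⁻¹ w.1) h
  exact Subtype.ext (by simpa [← Module.End.mul_apply, ← map_mul] using h')

theorem Weight.finrank_smul [N.Normal] [FiniteDimensional ℂ V] (μ : ρ.Weight N) (g : G) :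
    Module.finrank ℂ (ρ.weightSpace N (g • μ).1) = Module.finrank ℂ (ρ.weightSpace N μ.1) := by
  refine le_antisymm ?_ (μ.finrank_le_smul g)
  have h := (g • μ).finrank_le_smul g⁻¹
  rwa [inv_smul_smul] at h

section Irreducible

variable [Finite G]

/-- The weight spaces along one orbit span an invariant subspace, hence `V`; independence leaves no
room for a weight outside the orbit. -/
theorem IsIrreducible.weight_isPretransitive [N.Normal] (hρ : ρ.IsIrreducible)
    (hc : ∀ a ∈ N, ∀ b ∈ N, Commute (ρ a) (ρ b)) : MulAction.IsPretransitive G (ρ.Weight N) := by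
  refine ⟨fun μ ν => ?_⟩
  by_contra! h
  have hsup : ⨆ g : G, ρ.weightSpace N (g • μ).1 = ⊤ := by
    refine hρ.eq_top_of_invariant _ (fun g v hv => ?_) fun h0 => ?_
    · have : ⨆ g : G, ρ.weightSpace N (g • μ).1 ≤
          (⨆ g : G, ρ.weightSpace N (g • μ).1).comap (ρ g) :=
        iSup_le fun x v hv => Submodule.mem_iSup_of_mem (g * x) <| by
          rw [mul_smul]
          exact (x • μ).apply_mem g hv
      exact this hv
    · exact (1 • μ).2 (iSup_eq_bot.1 h0 1)
  refine ν.2 (disjoint_top.1 ((ρ.iSupIndep_weightSpace hc ν.1).mono_right ?_))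
  rw [← hsup]
  exact iSup_le fun g => le_iSup₂_of_le (g • μ).1 (fun h' => h g (Subtype.ext h')) le_rfl

variable [FiniteDimensional ℂ V]

theorem finite_weight (hc : ∀ a ∈ N, ∀ b ∈ N, Commute (ρ a) (ρ b)) : Finite (ρ.Weight N) :=
  WellFoundedGT.finite_ne_bot_of_iSupIndep (ρ.iSupIndep_weightSpace hc)

theorem IsIrreducible.card_weight_dvd [N.Normal] (hρ : ρ.IsIrreducible)
    (hc : ∀ a ∈ N, ∀ b ∈ N, Commute (ρ a) (ρ b)) :
    Nat.card (ρ.Weight N) ∣ Module.finrank ℂ V := by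
  classical
  have := finite_weight hc
  have := Fintype.ofFinite (ρ.Weight N)
  have hint : DirectSum.IsInternal fun μ : ρ.Weight N => ρ.weightSpace N μ.1 := by
    rw [DirectSum.isInternal_submodule_iff_iSupIndep_and_iSup_eq_top]
    refine ⟨(ρ.iSupIndep_weightSpace hc).comp Subtype.val_injective, ?_⟩
    rw [← ρ.iSup_weightSpace hc]
    exact iSup_ne_bot_subtype _
  rw [← (LinearEquiv.ofBijective (DirectSum.coeLinearMap _) hint).finrank_eq, Module.finrank_directSum]
  rcases isEmpty_or_nonempty (ρ.Weight N) with h | ⟨⟨μ⟩⟩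
  · simp
  rw [Finset.sum_congr rfl (g := fun _ => Module.finrank ℂ (ρ.weightSpace N μ.1))]
  · simp [Nat.card_eq_fintype_card]
  · intro ν _
    obtain ⟨g, rfl⟩ := (hρ.weight_isPretransitive hc).exists_smul_eq μ ν
    exact μ.finrank_smul g

theorem IsIrreducible.nonempty_weight (hρ : ρ.IsIrreducible)
    (hc : ∀ a ∈ N, ∀ b ∈ N, Commute (ρ a) (ρ b)) : Nonempty (ρ.Weight N) := by
  by_contra! h
  have h0 : (⊤ : Submodule ℂ V) = ⊥ := by
    rw [← ρ.iSup_weightSpace hc]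
    exact iSup_eq_bot.2 fun μ => by_contra fun hμ => h.false ⟨μ, hμ⟩
  have : (⊤ : Subrepresentation ρ) = ⊥ := Subrepresentation.toSubmodule_injective h0
  exact top_ne_bot this

end Irreducible

/-- A weight as a linear character. -/
noncomputable def Weight.toHom (μ : ρ.Weight N) : N →* ℂ where
  toFun := μ.1
  map_one' := by
    obtain ⟨v, hv, hv0⟩ := Submodule.exists_mem_ne_zero_of_ne_bot μ.2
    have := (mem_weightSpace ρ).1 hv 1
    refine smul_left_injective ℂ hv0 ?_
    simpa using this.symm
  map_mul' a b := by
    obtain ⟨v, hv, hv0⟩ := Submodule.exists_mem_ne_zero_of_ne_bot μ.2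
    have h := (mem_weightSpace ρ).1 hv
    refine smul_left_injective ℂ hv0 ?_
    have h' := h (a * b)
    rw [Subgroup.coe_mul, map_mul, Module.End.mul_apply, h b, map_smul, h a, smul_smul] at h'
    simpa [mul_comm] using h'.symm

theorem Weight.toHom_apply (μ : ρ.Weight N) (m : N) : μ.toHom m = μ.1 m := rfl

-- The trace of the projector onto a weight space is its dimension. For a real character,
-- conjugating `μ` conjugates this trace, so it stays nonzero.
open ComplexConjugate in
theorem Weight.star_weightSpace_ne_bot [Finite G] [FiniteDimensional ℂ V]
    (hreal : ∀ g, ∃ r : ℝ, ρ.character g = r) (μ : ρ.Weight N) :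
    ρ.weightSpace N (fun m => conj (μ.1 m)) ≠ ⊥ := by
  have := Fintype.ofFinite N
  have hcard : (Fintype.card N : ℂ) ≠ 0 := by exact_mod_cast Fintype.card_ne_zero
  have hinv : ∀ ν : N →* ℂ, ∀ m, ν m⁻¹ * ν m = 1 := fun ν m => by rw [← map_mul]; simp
  -- The averaging projector onto the `ν`-isotypic part.
  let e : (N →* ℂ) → V →ₗ[ℂ] V := fun ν => (Fintype.card N : ℂ)⁻¹ • ∑ m : N, ν m⁻¹ • ρ m
  have he : ∀ (ν : N →* ℂ) (m : N) v, ρ m (e ν v) = ν m • e ν v := by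
    intro ν m v
    simp only [e, LinearMap.smul_apply, LinearMap.sum_apply, map_smul, map_sum]
    rw [smul_comm (ν m) (Fintype.card N : ℂ)⁻¹, Finset.smul_sum (r := ν m)]
    congr 1
    refine Fintype.sum_equiv (Equiv.mulLeft m) _ (fun x => ν m • (ν x⁻¹ • ρ x v)) fun x => ?_
    simp only [Equiv.coe_mulLeft, mul_inv_rev, map_mul, smul_smul, Subgroup.coe_mul,
      Module.End.mul_apply]
    congr 1
    linear_combination (-ν x⁻¹) * hinv ν m
  have hproj : LinearMap.IsProj (ρ.weightSpace N μ.1) (e μ.toHom) := by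
    refine ⟨fun v => (mem_weightSpace ρ).2 fun m => he μ.toHom m v, fun v hv => ?_⟩
    have hv' := (mem_weightSpace ρ).1 hv
    have : ∀ m : N, μ.toHom m⁻¹ • ρ m v = v := fun m => by
      rw [hv', smul_smul, ← μ.toHom_apply, hinv, one_smul]
    simp only [e, LinearMap.smul_apply, LinearMap.sum_apply, this]
    simp only [Finset.sum_const, Finset.card_univ, ← Nat.cast_smul_eq_nsmul ℂ, smul_smul]
    rw [inv_mul_cancel₀ hcard, one_smul]
  have htr : LinearMap.trace ℂ V (e μ.toHom) ≠ 0 := by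
    rw [hproj.trace]
    exact_mod_cast (Nat.one_le_iff_ne_zero.1 (Submodule.one_le_finrank_iff.2 μ.2))
  let ν : N →* ℂ := (starRingEnd ℂ : ℂ →* ℂ).comp μ.toHom
  have htr' : LinearMap.trace ℂ V (e ν) = conj (LinearMap.trace ℂ V (e μ.toHom)) := by
    simp only [e, map_smul, map_sum, smul_eq_mul, map_mul, map_inv₀, Complex.conj_natCast]
    congr 1
    refine Finset.sum_congr rfl fun m _ => ?_
    obtain ⟨r, hr⟩ := hreal m
    change LinearMap.trace ℂ V (ρ m) = r at hr
    rw [hr, Complex.conj_ofReal]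
    rfl
  intro hbot
  have he0 : e ν = 0 := by
    ext v
    have : e ν v ∈ ρ.weightSpace N (fun m => conj (μ.1 m)) :=
      (mem_weightSpace ρ).2 fun m => he ν m v
    simpa [hbot] using this
  rw [he0, map_zero] at htr'
  exact htr (by simpa using congrArg conj htr'.symm)

end Representation

/-! ### Sylow fusion applied to weights -/

namespace Representation

variable {G V : Type*} [Group G] [Finite G] [AddCommGroup V] [Module ℂ V] [FiniteDimensional ℂ V]
  {ρ : Representation ℂ G V} {N : Subgroup G} {p : ℕ} [Fact p.Prime]

theorem IsIrreducible.exists_weight_fixed [N.Normal] (hρ : ρ.IsIrreducible)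
    (hc : ∀ a ∈ N, ∀ b ∈ N, Commute (ρ a) (ρ b)) (P : Sylow p G)
    (hp : ¬ p ∣ Module.finrank ℂ V) : ∃ μ : ρ.Weight N, ∀ x ∈ P, x • μ = μ := by
  obtain ⟨μ, hμ⟩ := P.isPGroup'.nonempty_fixed_point_of_prime_not_dvd_card (ρ.Weight N)
    fun h => hp (h.trans (hρ.card_weight_dvd hc))
  exact ⟨μ, fun x hx => hμ ⟨x, hx⟩⟩

open ComplexConjugate in
theorem IsIrreducible.weight_real [N.Normal] (hρ : ρ.IsIrreducible)
    (hc : ∀ a ∈ N, ∀ b ∈ N, Commute (ρ a) (ρ b)) (P : Sylow p G)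
    (hodd : Odd (Nat.card (Subgroup.normalizer (P : Set G))))
    (hreal : ∀ g, ∃ r : ℝ, ρ.character g = r) {μ : ρ.Weight N} (hμ : ∀ x ∈ P, x • μ = μ)
    (m : N) : conj (μ.1 m) = μ.1 m := by
  let ν : ρ.Weight N := ⟨fun m => conj (μ.1 m), μ.star_weightSpace_ne_bot hreal⟩
  have hstar : ∀ g : G, ∀ κ : ρ.Weight N, g • μ = κ → ∀ m, (g • ν).1 m = conj (κ.1 m) := by
    rintro g _ rfl m
    rfl
  have hν : ∀ x ∈ P, x • ν = ν := fun x hx => Subtype.ext (funext (hstar x μ (hμ x hx)))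
  obtain ⟨g, hg⟩ := (hρ.weight_isPretransitive hc).exists_smul_eq μ ν
  obtain ⟨n, hn, hnμ⟩ := P.exists_mem_normalizer_smul_eq hμ (g := g) (by rwa [hg])
  rw [hg] at hnμ
  have hnν : n • ν = μ := Subtype.ext <| funext fun m => by
    rw [hstar n ν hnμ]
    exact Complex.conj_conj _
  have hn2 : n ^ 2 ∈ MulAction.stabilizer G μ := by
    rw [MulAction.mem_stabilizer_iff, pow_two, mul_smul, hnμ, hnν]
  obtain ⟨j, hj⟩ : Odd (orderOf n) :=
    hodd.of_dvd_nat (Subgroup.orderOf_dvd_natCard _ hn)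
  have h1 : n ^ (2 * j) * n = 1 := by rw [← pow_succ, ← hj, pow_orderOf_eq_one]
  have h2 : n ∈ MulAction.stabilizer G μ := by
    -- Since `n` has odd order, `n⁻¹` is a power of `n ^ 2`.
    rw [← inv_mem_iff, ← eq_inv_of_mul_eq_one_left h1, pow_mul]
    exact pow_mem hn2 j
  have h3 : ν = μ := hnμ.symm.trans h2
  exact congrFun (congrArg Subtype.val h3) m

/-- A norm map: `c` lifts the product, in the abelianization of `N`, of the `P`-conjugates of `m`.
Conjugation by `P` only permutes the factors, and `φ` takes the same value on each. -/
theorem _root_.Subgroup.exists_conj_invariant_mod_commutator {G : Type*} [Group G]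
    (N : Subgroup G) [N.Normal] (P : Subgroup G) [Finite P] {A : Type*} [CommGroup A]
    (φ : N →* A) (hφ : ∀ x ∈ P, ∀ m, φ (MulAut.conjNormal x m) = φ m) (m : N) :
    ∃ c : N, φ c = φ m ^ Nat.card P ∧ ∀ x ∈ P, x * c⁻¹ * x⁻¹ * c ∈ ⁅N, N⁆ := by
  have := Fintype.ofFinite P
  obtain ⟨c, hc⟩ : ∃ c, Abelianization.of c =
      ∏ x : P, Abelianization.of (MulAut.conjNormal (x : G) m) :=
    QuotientGroup.mk_surjective _
  refine ⟨c, ?_, fun y hy => ?_⟩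
  · rw [← Abelianization.lift_apply_of φ, hc, map_prod]
    simp [hφ, Nat.card_eq_fintype_card]
  · have h : Abelianization.of (MulAut.conjNormal y c) = Abelianization.of c := by
      have h1 := congrArg (Abelianization.map (MulAut.conjNormal y : MulAut N).toMonoidHom) hc
      rw [Abelianization.map_of, map_prod] at h1
      refine h1.trans (Eq.trans ?_ hc.symm)
      refine Fintype.prod_equiv (Equiv.mulLeft (⟨y, hy⟩ : P)) _ _ fun x => ?_
      simp only [Abelianization.map_of, Equiv.coe_mulLeft, Subgroup.coe_mul, map_mul]
      rfl
    have h2 : (MulAut.conjNormal y c)⁻¹ * c ∈ commutator N := by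
      rw [← Abelianization.ker_of, MonoidHom.mem_ker, map_mul, map_inv, h, inv_mul_cancel]
    rw [← Subgroup.map_subtype_commutator]
    refine ⟨_, h2, ?_⟩
    simp [mul_assoc]

theorem _root_.Complex.eq_one_of_conj_eq_of_pow {z : ℂ} (hz : (starRingEnd ℂ) z = z) {k : ℕ} (hk : Odd k)
    (h : z ^ k = 1) : z = 1 := by
  obtain ⟨r, rfl⟩ := Complex.conj_eq_iff_real.1 hz
  have : r ^ k = 1 ^ k := by rw [one_pow]; exact_mod_cast h
  rw [hk.strictMono_pow.injective this, Complex.ofReal_one]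

/-- If `N_G(P)` has odd order and the irreducible representation `ρ` has real character and degree
prime to `p`, then a normal subgroup whose image under `ρ` is abelian acts trivially. -/
theorem IsIrreducible.le_ker_of_commutator_le_ker [N.Normal] (hρ : ρ.IsIrreducible)
    (P : Sylow p G) (hodd : Odd (Nat.card (Subgroup.normalizer (P : Set G))))
    (hp : ¬ p ∣ Module.finrank ℂ V) (hreal : ∀ g, ∃ r : ℝ, ρ.character g = r)
    (hN : ⁅N, N⁆ ≤ MonoidHom.ker ρ) : N ≤ MonoidHom.ker ρ := by
  have hc : ∀ a ∈ N, ∀ b ∈ N, Commute (ρ a) (ρ b) := fun a ha b hb => by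
    have h : ρ (a * b * a⁻¹ * b⁻¹) = 1 := hN (Subgroup.commutator_mem_commutator ha hb)
    have h' : ρ (a * b * a⁻¹ * b⁻¹ * (b * a)) = ρ (b * a) := by rw [map_mul, h, one_mul]
    rw [commute_iff_eq, ← map_mul, ← map_mul, ← h']
    congr 1
    group
  obtain ⟨μ, hμ⟩ := hρ.exists_weight_fixed hc P hp
  have hμreal := hρ.weight_real hc P hodd hreal hμ
  have hPodd : Odd (Nat.card P) :=
    hodd.of_dvd_nat (Subgroup.card_dvd_of_le Subgroup.le_normalizer)
  obtain ⟨v, hv, hv0⟩ := Submodule.exists_mem_ne_zero_of_ne_bot μ.2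
  have hv' := (mem_weightSpace ρ).1 hv
  have hμ1 : ∀ m : N, μ.1 m = 1 := by
    intro m
    obtain ⟨c, hcm, hcP⟩ := N.exists_conj_invariant_mod_commutator P μ.toHom.toHomUnits
      (fun x hx m => Units.ext <| by
        have := congrFun (congrArg Subtype.val (hμ x⁻¹ (inv_mem hx))) m
        rw [Weight.smul_val, inv_inv] at this
        exact this) m
    have hcm' : μ.1 c = μ.1 m ^ Nat.card P := by
      simpa [Weight.toHom_apply] using congrArg Units.val hcm
    -- `P` fixes the cosets of 1 and of `c`, so fusion puts `c` in `N_G(P) * ker ρ`.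
    obtain ⟨n, hn, hnc⟩ := P.exists_mem_normalizer_smul_eq
      (a := ((1 : G) : G ⧸ ((P : Subgroup G) ⊔ MonoidHom.ker ρ))) (g := c)
      (fun x hx => by
        rw [MulAction.Quotient.smul_coe, QuotientGroup.eq]
        simpa using Subgroup.mem_sup_left hx)
      (fun x hx => by
        rw [MulAction.Quotient.smul_coe, MulAction.Quotient.smul_coe, QuotientGroup.eq]
        have := mul_mem (Subgroup.mem_sup_left (T := MonoidHom.ker ρ) (inv_mem hx))
          (Subgroup.mem_sup_right (S := (P : Subgroup G)) (hN (hcP x hx)))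
        simpa [mul_assoc] using this)
    rw [MulAction.Quotient.smul_coe, MulAction.Quotient.smul_coe, QuotientGroup.eq,
      Subgroup.mem_sup_of_normal_right] at hnc
    obtain ⟨y, hy, k, hk, hyk⟩ := hnc
    have hny : n * y ∈ Subgroup.normalizer (P : Set G) :=
      mul_mem hn (Subgroup.le_normalizer hy)
    have hρc : ρ c = ρ (n * y) := by
      have : (c : G) = n * y * k := by
        rw [mul_assoc, hyk, smul_eq_mul, smul_eq_mul, mul_one, mul_one, mul_inv_cancel_left]
      rw [this, map_mul, MonoidHom.mem_ker.1 hk, mul_one]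
    have hodd' := hodd.of_dvd_nat (Subgroup.orderOf_dvd_natCard _ hny)
    have hpow : ∀ j : ℕ, (ρ c ^ j) v = μ.1 c ^ j • v := by
      intro j
      induction j with
      | zero => simp
      | succ j ih => rw [pow_succ, Module.End.mul_apply, hv', map_smul, ih, smul_smul, pow_succ']
    have hc1 : μ.1 c = 1 := by
      refine Complex.eq_one_of_conj_eq_of_pow (hμreal c) hodd' (smul_left_injective ℂ hv0 ?_)
      have := hpow (orderOf (n * y))
      rw [hρc, ← map_pow, pow_orderOf_eq_one, map_one] at this
      simpa using this.symm
    exact Complex.eq_one_of_conj_eq_of_pow (hμreal m) hPodd (hcm'.symm.trans hc1)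
  have htop : ρ.weightSpace N (fun _ => 1) = ⊤ := by
    refine hρ.eq_top_of_invariant _ (fun g w hw => apply_mem_weightSpace hw g) ?_
    rw [← funext hμ1]
    exact μ.2
  intro g hg
  rw [MonoidHom.mem_ker]
  ext w
  have hw : w ∈ ρ.weightSpace N (fun _ => 1) := htop ▸ Submodule.mem_top
  simpa using (mem_weightSpace ρ).1 hw ⟨g, hg⟩

theorem IsIrreducible.le_ker_of_isSolvable [N.Normal] [Group.IsSolvable N] (hρ : ρ.IsIrreducible)
    (P : Sylow p G) (hodd : Odd (Nat.card (Subgroup.normalizer (P : Set G))))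
    (hp : ¬ p ∣ Module.finrank ℂ V) (hreal : ∀ g, ∃ r : ℝ, ρ.character g = r) :
    N ≤ MonoidHom.ker ρ := by
  obtain ⟨k, hk⟩ := Group.IsSolvable.solvable (G := N)
  -- The induction climbs from the trivial term of the derived series up to `N`.
  have key : ∀ i ≤ k, (derivedSeries N (k - i)).map N.subtype ≤ MonoidHom.ker ρ := by
    intro i
    induction i with
    | zero => simp [hk]
    | succ i ih =>
      intro hi
      refine hρ.le_ker_of_commutator_le_ker P hodd hp hreal ?_
      rw [← Subgroup.map_commutator, ← derivedSeries_succ, show k - (i + 1) + 1 = k - i by omega]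
      exact ih (by omega)
  simpa [derivedSeries_zero, ← MonoidHom.range_eq_map] using key k le_rfl

end Representation

theorem theoremC {G : Type*} [Group G] [Finite G] (p : ℕ) (hp : p.Prime) (P : Sylow p G)
    (hodd : Odd (Nat.card (Subgroup.normalizer (P : Set G))))
    (χ : G → ℂ) (hχ : χ ∈ irrPrimeDegree p G) (hreal : IsRealValued χ)
    (N : Subgroup G) (hN : N.Normal) (hsolv : Group.IsSolvable N) :
    (N : Set G) ⊆ characterKernel χ := by
  have := Fact.mk hp
  obtain ⟨⟨n, ρ, hρ, rfl⟩, d, hd, hpd⟩ := hχ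
  rw [Representation.char_one, Nat.cast_inj] at hd
  intro g hg
  have hg' := hρ.le_ker_of_isSolvable P hodd (hd ▸ hpd) hreal hg
  change LinearMap.trace ℂ _ (ρ g) = LinearMap.trace ℂ _ (ρ 1)
  rw [MonoidHom.mem_ker.1 hg', map_one ρ]
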